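/- Let $H^2(\mathbb D)$ and $H^2(\mathbb D^2)$ denote the Hardy spaces of the unit disc and of the bidisc, identified through boundary values with the closed subspaces of $L^2(\mathbb T)$ and $L^2(\mathbb T^2)$ (normalized Lebesgue measure) of functions whose Fourier coefficients vanish unless all their indices are nonnegative. Let $T$ be the multiplication by the coordinate on $H^2(\mathbb D)$, and let $M_1,M_2$ be the multiplications by the coordinates $z,w$ on $H^2(\mathbb D^2)$. A quotient module of $H^2(\mathbb D)$ (resp. $H^2(\mathbb D^2)$) is a closed subspace invariant under $T^*$ (resp. under $M_1^*$ and $M_2^*$). For a quotient module $\mathfrak Q$ of $H^2(\mathbb D^2)$ put $Q_i=P_{\mathfrak Q}M_i|_{\mathfrak Q}$, $i=1,2$, where $P_{\mathfrak Q}$ is the orthogonal projection onto $\mathfrak Q$; $\mathfrak Q$ is nontrivial if $\mathfrak Q\neq\{0\}$, doubly commuting if $Q_1^*Q_2=Q_2Q_1^*$, and $\varphi$-doubly commuting if $Q_1Q_2Q_2^*=Q_2^*Q_1Q_2$. For subspaces $\mathfrak Q_1,\mathfrak Q_2$ of $H^2(\mathbb D)$, $\mathfrak Q_1\otimes\mathfrak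 Q_2\subseteq H^2(\mathbb D^2)$ denotes the closed linear span of the functions $f(z)g(w)$ with $f\in\mathfrak Q_1$, $g\in\mathfrak Q_2$. An inner function $\theta$ on $\mathbb D$ is a bounded holomorphic function with boundary values of modulus $1$ almost everywhere on $\mathbb T$. For $a\in\mathbb D$ and $c\in\mathbb T$ let $f_{a,c}(z)=c\,\dfrac{z-a}{1-\bar a z}$. **Theorem 3.5.** Let $\mathfrak Q_1,\mathfrak Q_2$ be quotient modules of $H^2(\mathbb D)$ such that $\mathfrak Q=\mathfrak Q_1\otimes\mathfrak Q_2$ is a nontrivial doubly commuting quotient module of $H^2(\mathbb D^2)$. Then $\mathfrak Q$ is $\varphi$-doubly commuting if and only if one of the following holds: (i) $\mathfrak Q_1=H^2(\mathbb D)$ and $\mathfrak Q_2=H^2(\mathbb D)\ominus f_{a,c}H^2(\mathbb D)$ for some $a\in\mathbb D$, $c\in\mathbb T$; (ii) $\mathfrak Q_1=H^2(\mathbb D)\ominus f_{0,c}H^2(\mathbb D)$ for some $c\in\mathbb T$, and $\mathfrak Q_2=H^2(\mathbb D)$; (iii) $\mathfrak Q_1=H^2(\mathbb D)\ominus\theta_1H^2(\mathbb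 D)$ and $\mathfrak Q_2=H^2(\mathbb D)\ominus\theta_2H^2(\mathbb D)$ for some inner functions $\theta_1,\theta_2$ on $\mathbb D$ such that $\theta_1=f_{0,c}$ for some $c\in\mathbb T$, or $\theta_2=f_{a,c}$ for some $a\in\mathbb D$, $c\in\mathbb T$. -/

import Mathlib

open MeasureTheory AddCircle
open scoped ComplexConjugate ENNReal InnerProductSpace InnerProduct

noncomputable section

/-! ### Generalities: compressions and quotient modules of a Hilbert module -/

section HilbertModule

variable {H : Type*} [NormedAddCommGroup H] [InnerProductSpace ℂ H] [CompleteSpace H]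

/-- A closed subspace `Q` of a Hilbert space is a quotient module, with respect to a family `M` of
module multiplication operators, if it is invariant under the adjoints of these operators. -/
structure IsQuotientModule (M : Set (H →L[ℂ] H)) (Q : Submodule ℂ H) : Prop where
  isClosed : IsClosed (Q : Set H)
  adjoint_mem : ∀ T ∈ M, ∀ f ∈ Q, ContinuousLinearMap.adjoint T f ∈ Q

/-- The compression `P_Q T |_Q` of an operator `T` to a closed subspace `Q`. -/
def compression (Q : Submodule ℂ H) [CompleteSpace Q] (T : H →L[ℂ] H) : Q →L[ℂ] Q :=
  Q.orthogonalProjectionOnto ∘L T ∘L Q.subtypeL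

/-- `[Q₁^*, Q₂] = 0`, where `Q₁`, `Q₂` are the compressions to `Q` of `M₁`, `M₂`. -/
def IsDoublyCommuting (M₁ M₂ : H →L[ℂ] H) (Q : Submodule ℂ H) [CompleteSpace Q] : Prop :=
  ContinuousLinearMap.adjoint (compression Q M₁) ∘L compression Q M₂ =
    compression Q M₂ ∘L ContinuousLinearMap.adjoint (compression Q M₁)

/-- `Q₁ Q₂ Q₂^* = Q₂^* Q₁ Q₂`, where `Q₁`, `Q₂` are the compressions to `Q` of `M₁`, `M₂`. -/
def IsPhiDoublyCommuting (M₁ M₂ : H →L[ℂ] H) (Q : Submodule ℂ H) [CompleteSpace Q] : Prop :=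
  compression Q M₁ ∘L compression Q M₂ ∘L ContinuousLinearMap.adjoint (compression Q M₂) =
    ContinuousLinearMap.adjoint (compression Q M₂) ∘L compression Q M₁ ∘L compression Q M₂

end HilbertModule

/-! ### Multiplication by a continuous function on `L²` -/

section Multiplication

variable {X : Type*} [TopologicalSpace X] [CompactSpace X]
  [MeasurableSpace X] [BorelSpace X] (μ : Measure X) [IsFiniteMeasure μ]

/-- Multiplication by the continuous function `u` as an operator on `L²(μ)`. -/
def mulL2 (u : C(X, ℂ)) : Lp ℂ 2 μ →L[ℂ] Lp ℂ 2 μ :=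
  (ContinuousLinearMap.mul ℂ ℂ).holderL μ ∞ 2 2 (ContinuousMap.toLp (E := ℂ) ∞ μ ℂ u)

theorem mulL2_ae (u : C(X, ℂ)) (f : Lp ℂ 2 μ) : mulL2 μ u f =ᵐ[μ] fun x => u x * f x := by
  have h1 := (ContinuousLinearMap.mul ℂ ℂ).coeFn_holder (r := 2)
    (ContinuousMap.toLp (E := ℂ) ∞ μ ℂ u) f
  have h2 := ContinuousMap.coeFn_toLp (p := ∞) (𝕜 := ℂ) μ u
  filter_upwards [h1, h2] with x hx1 hx2
  exact hx1.trans (by rw [ContinuousLinearMap.mul_apply', hx2])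

theorem inner_mulL2 (u v w : C(X, ℂ)) (h : ∀ x, conj (v x) * u x = conj (w x)) (f : Lp ℂ 2 μ) :
    inner ℂ (ContinuousMap.toLp (E := ℂ) 2 μ ℂ v) (mulL2 μ u f) =
      inner ℂ (ContinuousMap.toLp (E := ℂ) 2 μ ℂ w) f := by
  rw [L2.inner_def, L2.inner_def]
  refine integral_congr_ae ?_
  filter_upwards [mulL2_ae μ u f, ContinuousMap.coeFn_toLp (p := 2) (𝕜 := ℂ) μ v,
    ContinuousMap.coeFn_toLp (p := 2) (𝕜 := ℂ) μ w] with x h1 h2 h3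
  simp only [RCLike.inner_apply, h1, h2, h3, ← h]
  ring

end Multiplication

/-! ### The Hardy space of the disc

The circle is `UnitAddCircle = ℝ/ℤ` with normalized Lebesgue measure, its coordinate function is
`z = fourier 1`, that is `t ↦ exp (2 π i t)`. Hardy space functions are represented by their boundary
values. -/

/-- Normalized Lebesgue measure on the circle. -/
abbrev circleMeasure : Measure UnitAddCircle := haarAddCircle

/-- `H²(𝔻)`: the functions in `L²(𝕋)` all of whose Fourier coefficients of negative index vanish. -/
def hardyDisc : Submodule ℂ (Lp ℂ 2 circleMeasure) where
  carrier := {f | ∀ n : ℤ, n < 0 → inner ℂ (fourierLp 2 n) f = 0}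
  add_mem' hf hg n hn := by rw [inner_add_right, hf n hn, hg n hn, add_zero]
  zero_mem' n _ := inner_zero_right _
  smul_mem' c f hf n hn := by rw [inner_smul_right, hf n hn, mul_zero]

theorem isClosed_hardyDisc : IsClosed (hardyDisc : Set (Lp ℂ 2 circleMeasure)) := by
  have : (hardyDisc : Set (Lp ℂ 2 circleMeasure)) =
      ⋂ n : ℤ, ⋂ _ : n < 0, {f | inner ℂ (fourierLp 2 n) f = 0} := by
    ext f; simp [hardyDisc]
  rw [this]
  exact isClosed_iInter fun n => isClosed_iInter fun _ =>
    isClosed_eq (by fun_prop) continuous_const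

instance : CompleteSpace hardyDisc := isClosed_hardyDisc.completeSpace_coe

/-- The shift `T_z` on `H²(𝔻)`: multiplication by the coordinate function. -/
def hardyShift : hardyDisc →L[ℂ] hardyDisc :=
  (mulL2 circleMeasure (fourier 1) ∘L hardyDisc.subtypeL).codRestrict hardyDisc <| by
    intro f n hn
    have h := inner_mulL2 circleMeasure (fourier 1) (fourier n) (fourier (n - 1))
      (fun x => by
        rw [← fourier_neg, ← fourier_neg, ← fourier_add]; congr 2; ring) (f : Lp ℂ 2 circleMeasure)
    exact h.trans (f.2 (n - 1) (by omega))

/-- `θ` is (the boundary function on the circle of) an inner function on the disc: a measurable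
unimodular function all of whose Fourier coefficients of negative index vanish. -/
structure IsInner (θ : UnitAddCircle → ℂ) : Prop where
  aestronglyMeasurable : AEStronglyMeasurable θ circleMeasure
  norm_eq_one : ∀ᵐ t ∂circleMeasure, ‖θ t‖ = 1
  fourierCoeff_eq_zero : ∀ n : ℤ, n < 0 → fourierCoeff θ n = 0

/-- `θ H²(𝔻)`, as a subspace of `H²(𝔻)`. -/
def mulHardy (θ : UnitAddCircle → ℂ) : Submodule ℂ hardyDisc where
  carrier := {f | ∃ g : hardyDisc,
    (f : Lp ℂ 2 circleMeasure) =ᵐ[circleMeasure] fun t => θ t * (g : Lp ℂ 2 circleMeasure) t}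
  add_mem' := by
    rintro f₁ f₂ ⟨g₁, h₁⟩ ⟨g₂, h₂⟩
    refine ⟨g₁ + g₂, ?_⟩
    filter_upwards [h₁, h₂, Lp.coeFn_add (f₁ : Lp ℂ 2 circleMeasure) (f₂ : Lp ℂ 2 circleMeasure),
      Lp.coeFn_add (g₁ : Lp ℂ 2 circleMeasure) (g₂ : Lp ℂ 2 circleMeasure)] with t a b c d
    simp only [Submodule.coe_add, c, d, Pi.add_apply, a, b, mul_add]
  zero_mem' := by
    refine ⟨0, ?_⟩
    filter_upwards [Lp.coeFn_zero ℂ 2 circleMeasure] with t a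
    have h0 : ((0 : Lp ℂ 2 circleMeasure) : UnitAddCircle → ℂ) t = 0 := a
    rw [ZeroMemClass.coe_zero, h0, mul_zero]
  smul_mem' := by
    rintro c f ⟨g, h⟩
    refine ⟨c • g, ?_⟩
    filter_upwards [h, Lp.coeFn_smul c (f : Lp ℂ 2 circleMeasure),
      Lp.coeFn_smul c (g : Lp ℂ 2 circleMeasure)] with t a b d
    simp only [Submodule.coe_smul, b, d, Pi.smul_apply, a, smul_eq_mul]
    ring

/-- The model space `H²(𝔻) ⊖ θ H²(𝔻)`. -/
def modelSpace (θ : UnitAddCircle → ℂ) : Submodule ℂ hardyDisc := (mulHardy θ)ᗮ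

/-- The boundary function of the automorphism `z ↦ c (z - a) / (1 - conj a * z)` of the disc,
where `|a| < 1` and `|c| = 1`. -/
def discAut (a c : ℂ) (t : UnitAddCircle) : ℂ :=
  c * ((fourier 1 t - a) / (1 - conj a * fourier 1 t))

/-! ### The Hardy space of the bidisc -/

/-- Normalized Lebesgue measure on the torus. -/
abbrev torusMeasure : Measure (UnitAddCircle × UnitAddCircle) := circleMeasure.prod circleMeasure

/-- The monomial `z ^ m * w ^ n` on the torus. -/
def torusMonomial (m n : ℤ) : C(UnitAddCircle × UnitAddCircle, ℂ) where
  toFun p := fourier m p.1 * fourier n p.2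

/-- `H²(𝔻²)`: the functions in `L²(𝕋²)` all of whose Fourier coefficients of index `(m, n)` with
`m < 0` or `n < 0` vanish. -/
def hardyBidisc : Submodule ℂ (Lp ℂ 2 torusMeasure) where
  carrier := {f | ∀ m n : ℤ, m < 0 ∨ n < 0 →
    inner ℂ (ContinuousMap.toLp (E := ℂ) 2 torusMeasure ℂ (torusMonomial m n)) f = 0}
  add_mem' hf hg m n h := by rw [inner_add_right, hf m n h, hg m n h, add_zero]
  zero_mem' m n _ := inner_zero_right _
  smul_mem' c f hf m n h := by rw [inner_smul_right, hf m n h, mul_zero]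

theorem isClosed_hardyBidisc : IsClosed (hardyBidisc : Set (Lp ℂ 2 torusMeasure)) := by
  have : (hardyBidisc : Set (Lp ℂ 2 torusMeasure)) =
      ⋂ m : ℤ, ⋂ n : ℤ, ⋂ _ : m < 0 ∨ n < 0,
        {f | inner ℂ (ContinuousMap.toLp (E := ℂ) 2 torusMeasure ℂ (torusMonomial m n)) f = 0} := by
    ext f; simp [hardyBidisc]
  rw [this]
  exact isClosed_iInter fun m => isClosed_iInter fun n => isClosed_iInter fun _ =>
    isClosed_eq (by fun_prop) continuous_const

instance : CompleteSpace hardyBidisc := isClosed_hardyBidisc.completeSpace_coe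

/-- `M₁` on `H²(𝔻²)`: multiplication by the first coordinate `z`. -/
def bidiscShift₁ : hardyBidisc →L[ℂ] hardyBidisc :=
  (mulL2 torusMeasure (torusMonomial 1 0) ∘L hardyBidisc.subtypeL).codRestrict hardyBidisc <| by
    intro f m n h
    have h' := inner_mulL2 torusMeasure (torusMonomial 1 0) (torusMonomial m n)
      (torusMonomial (m - 1) n) (fun x => by
        have : fourier (-(m - 1)) x.1 = fourier (-m) x.1 * fourier 1 x.1 := by
          rw [← fourier_add]; congr 2; ring
        simp only [torusMonomial, ContinuousMap.coe_mk, map_mul, ← fourier_neg, fourier_zero, this]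
        ring) (f : Lp ℂ 2 torusMeasure)
    exact h'.trans (f.2 (m - 1) n (by omega))

/-- `M₂` on `H²(𝔻²)`: multiplication by the second coordinate `w`. -/
def bidiscShift₂ : hardyBidisc →L[ℂ] hardyBidisc :=
  (mulL2 torusMeasure (torusMonomial 0 1) ∘L hardyBidisc.subtypeL).codRestrict hardyBidisc <| by
    intro f m n h
    have h' := inner_mulL2 torusMeasure (torusMonomial 0 1) (torusMonomial m n)
      (torusMonomial m (n - 1)) (fun x => by
        have : fourier (-(n - 1)) x.2 = fourier (-n) x.2 * fourier 1 x.2 := by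
          rw [← fourier_add]; congr 2; ring
        simp only [torusMonomial, ContinuousMap.coe_mk, map_mul, ← fourier_neg, fourier_zero, this]
        ring) (f : Lp ℂ 2 torusMeasure)
    exact h'.trans (f.2 m (n - 1) (by omega))

/-! ### Tensor products of subspaces -/

theorem memLp_pureTensor (f g : Lp ℂ 2 circleMeasure) :
    MemLp (fun p : UnitAddCircle × UnitAddCircle => f p.1 * g p.2) 2 torusMeasure := by
  have hf := Lp.memLp f
  have hg := Lp.memLp g
  refine (memLp_two_iff_integrable_sq_norm (hf.1.comp_fst.mul hg.1.comp_snd)).2 ?_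
  refine (((memLp_two_iff_integrable_sq_norm hf.1).1 hf).mul_prod
    ((memLp_two_iff_integrable_sq_norm hg.1).1 hg)).congr (Filter.Eventually.of_forall fun p => ?_)
  simp [mul_pow]

/-- The function `(z, w) ↦ f z * g w`, for `f, g` in `H²(𝔻)`, as an element of `H²(𝔻²)`. -/
def pureTensor (f g : hardyDisc) : hardyBidisc :=
  ⟨(memLp_pureTensor f g).toLp, by
    intro m n h
    have key : inner ℂ (ContinuousMap.toLp (E := ℂ) 2 torusMeasure ℂ (torusMonomial m n))
        (memLp_pureTensor f g).toLp =
        inner ℂ (fourierLp 2 m) (f : Lp ℂ 2 circleMeasure) *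
          inner ℂ (fourierLp 2 n) (g : Lp ℂ 2 circleMeasure) := by
      rw [L2.inner_def, L2.inner_def, L2.inner_def, ← integral_prod_mul]
      refine integral_congr_ae ?_
      have hm : ∀ᵐ p ∂torusMeasure, fourierLp (T := 1) 2 m p.1 = fourier m p.1 :=
        Measure.quasiMeasurePreserving_fst.ae (coeFn_fourierLp 2 m)
      have hn : ∀ᵐ p ∂torusMeasure, fourierLp (T := 1) 2 n p.2 = fourier n p.2 :=
        Measure.quasiMeasurePreserving_snd.ae (coeFn_fourierLp 2 n)
      filter_upwards [(memLp_pureTensor f g).coeFn_toLp,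
        ContinuousMap.coeFn_toLp (p := 2) (𝕜 := ℂ) torusMeasure (torusMonomial m n), hm, hn]
        with p h1 h2 h3 h4
      simp only [RCLike.inner_apply, h1, h2, h3, h4]
      simp only [torusMonomial, ContinuousMap.coe_mk, map_mul]
      ring
    rw [key]
    rcases h with h | h
    · rw [f.2 m h, zero_mul]
    · rw [g.2 n h, mul_zero]⟩

/-- `Q₁ ⊗ Q₂` under the identification `H²(𝔻²) = H²(𝔻) ⊗ H²(𝔻)`: the closed linear span of the
functions `f z * g w` with `f` in `Q₁` and `g` in `Q₂`. -/
def tensorSubspace (Q₁ Q₂ : Submodule ℂ hardyDisc) : Submodule ℂ hardyBidisc :=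
  (Submodule.span ℂ {F | ∃ f ∈ Q₁, ∃ g ∈ Q₂, F = pureTensor f g}).topologicalClosure

instance (Q₁ Q₂ : Submodule ℂ hardyDisc) : CompleteSpace (tensorSubspace Q₁ Q₂) :=
  inferInstanceAs (CompleteSpace (Submodule.topologicalClosure _))

end

/-!
On elementary tensors, with `A` and `B` the compressions of the shift to `Q₁` and `Q₂`, the
`φ`-doubly commuting identity reads `A f ⊗ B B† g = A f ⊗ B† B g`, so it says that `A = 0` or `B` is
normal. On a quotient module `B B† = 1 - u ⊗ u`, where `u` is the projection of the constant
function `1`. If `B` is normal, then `B†` commutes with `u ⊗ u` and hence preserves `uᗮ`; since a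
subspace invariant under the backward shift and orthogonal to `1` is zero, the quotient module is
spanned by `u`. It is then an eigenspace of the backward shift, which is the model space of a Möbius
map, and it is the eigenspace of `0` when the compression vanishes. The other tensor factor is
described by Beurling's theorem: a unit vector of `Qᗮ ⊖ z Qᗮ` is unimodular, because `|φ|² dt` has
the Fourier coefficients of `dt`, and is the inner function of `Q`.
-/

noncomputable section

open ContinuousLinearMap (adjoint adjoint_inner_left adjoint_inner_right)
open Module.End (eigenspace mem_eigenspace_iff)

/-! ### Compressions of the unilateral shift -/

section Adjoint

variable {𝕜 E : Type*} [RCLike 𝕜] [NormedAddCommGroup E] [InnerProductSpace 𝕜 E] [CompleteSpace E]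

theorem adjoint_apply_eq_smul {T : E →L[𝕜] E} {a : 𝕜} (h : ∀ f, T f = a • f) (f : E) :
    adjoint T f = conj a • f :=
  ext_inner_right 𝕜 fun g => by
    rw [adjoint_inner_left, h, inner_smul_right, inner_smul_left, RCLike.conj_conj]

theorem forall_apply_eq_smul_iff_adjoint {T : E →L[𝕜] E} {a : 𝕜} :
    (∀ f, T f = a • f) ↔ ∀ f, adjoint T f = conj a • f := by
  refine ⟨adjoint_apply_eq_smul, fun h f => ?_⟩
  rw [← ContinuousLinearMap.adjoint_adjoint T, adjoint_apply_eq_smul h, RCLike.conj_conj]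

theorem mem_eigenspace_adjoint_iff {T : E →L[𝕜] E} {a c : 𝕜} (hc : c ≠ 0) {f : E} :
    f ∈ eigenspace (adjoint T : E →ₗ[𝕜] E) (conj a) ↔ ∀ g, inner 𝕜 (c • (T g - a • g)) f = 0 := by
  have hinner (g : E) :
      inner 𝕜 (c • (T g - a • g)) f = conj c * inner 𝕜 g (adjoint T f - conj a • f) := by
    rw [inner_smul_left, inner_sub_left, inner_sub_right, inner_smul_left, inner_smul_right,
      adjoint_inner_right]
  simp only [hinner, mul_eq_zero, map_eq_zero, hc, false_or]
  rw [mem_eigenspace_iff, ← sub_eq_zero]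
  exact ⟨fun h g => (congrArg _ h).trans (inner_zero_right g), fun h => inner_self_eq_zero.1 (h _)⟩

end Adjoint

section Compression

variable {H : Type*} [NormedAddCommGroup H] [InnerProductSpace ℂ H] {Q : Submodule ℂ H}

theorem inner_compression [CompleteSpace Q] (T : H →L[ℂ] H) (f g : Q) :
    inner ℂ f (compression Q T g) = inner ℂ (f : H) (T g) :=
  Submodule.inner_orthogonalProjectionOnto_eq_of_mem_left f (T g)

namespace IsQuotientModule

variable [CompleteSpace H] {M : Set (H →L[ℂ] H)} {T : H →L[ℂ] H}

theorem apply_mem_orthogonal (hQ : IsQuotientModule M Q) (hT : T ∈ M) {g : H} (hg : g ∈ Qᗮ) :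
    T g ∈ Qᗮ := by
  rw [Submodule.mem_orthogonal] at hg ⊢
  intro f hf
  rw [← adjoint_inner_left]
  exact hg _ (hQ.adjoint_mem T hT f hf)

variable [CompleteSpace Q]

theorem coe_adjoint_compression (hQ : IsQuotientModule M Q) (hT : T ∈ M) (f : Q) :
    (adjoint (compression Q T) f : H) = adjoint T (f : H) := by
  suffices h : adjoint (compression Q T) f = ⟨adjoint T (f : H), hQ.adjoint_mem T hT f f.2⟩ by
    rw [h]
  refine ext_inner_right ℂ fun g => ?_
  rw [adjoint_inner_left, inner_compression, Submodule.coe_inner, adjoint_inner_left]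

theorem forall_compression_apply_eq_smul_iff (hQ : IsQuotientModule M Q) (hT : T ∈ M) {a : ℂ} :
    (∀ f, compression Q T f = a • f) ↔ Q ≤ eigenspace (adjoint T : H →ₗ[ℂ] H) (conj a) := by
  rw [forall_apply_eq_smul_iff_adjoint, SetLike.le_def]
  refine Subtype.forall.trans (forall₂_congr fun f hf => ?_)
  rw [Subtype.ext_iff, hQ.coe_adjoint_compression hT, mem_eigenspace_iff]
  rfl

end IsQuotientModule

end Compression

section UnilateralShift

variable {𝕜 H : Type*} [RCLike 𝕜] [NormedAddCommGroup H] [InnerProductSpace 𝕜 H]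

theorem hilbertBasis_ext_inner {ι : Type*} (b : HilbertBasis ι 𝕜 H) {f g : H}
    (h : ∀ i, inner 𝕜 (b i) f = inner 𝕜 (b i) g) : f = g := by
  refine b.repr.injective (lp.ext (funext fun i => ?_))
  rw [b.repr_apply_apply, b.repr_apply_apply, h]

/-- `S` is the unilateral shift along the orthonormal basis `b`. -/
def IsUnilateralShift (b : HilbertBasis ℕ 𝕜 H) (S : H →L[𝕜] H) : Prop :=
  ∀ n, S (b n) = b (n + 1)

namespace IsUnilateralShift

variable {b : HilbertBasis ℕ 𝕜 H} {S : H →L[𝕜] H} [CompleteSpace H]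

theorem inner_adjoint_apply (hS : IsUnilateralShift b S) (n : ℕ) (f : H) :
    inner 𝕜 (b n) (adjoint S f) = inner 𝕜 (b (n + 1)) f := by
  rw [adjoint_inner_right, hS]

theorem adjoint_apply_zero (hS : IsUnilateralShift b S) : adjoint S (b 0) = 0 :=
  hilbertBasis_ext_inner b fun n => by
    rw [hS.inner_adjoint_apply, b.orthonormal.2 n.succ_ne_zero, inner_zero_right]

theorem adjoint_apply_succ (hS : IsUnilateralShift b S) (n : ℕ) :
    adjoint S (b (n + 1)) = b n :=
  hilbertBasis_ext_inner b fun m => by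
    classical
    simp only [hS.inner_adjoint_apply, orthonormal_iff_ite.1 b.orthonormal, add_left_inj]

theorem inner_zero_apply (hS : IsUnilateralShift b S) (f : H) : inner 𝕜 (b 0) (S f) = 0 := by
  rw [← adjoint_inner_left, hS.adjoint_apply_zero, inner_zero_left]

theorem inner_succ_apply (hS : IsUnilateralShift b S) (n : ℕ) (f : H) :
    inner 𝕜 (b (n + 1)) (S f) = inner 𝕜 (b n) f := by
  rw [← adjoint_inner_left, hS.adjoint_apply_succ]

theorem adjoint_apply_apply (hS : IsUnilateralShift b S) (f : H) : adjoint S (S f) = f :=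
  hilbertBasis_ext_inner b fun n => by rw [hS.inner_adjoint_apply, hS.inner_succ_apply]

theorem apply_adjoint_apply (hS : IsUnilateralShift b S) (f : H) :
    S (adjoint S f) = f - inner 𝕜 (b 0) f • b 0 := by
  refine hilbertBasis_ext_inner b fun n => ?_
  rw [inner_sub_right, inner_smul_right]
  cases n with
  | zero =>
    rw [hS.inner_zero_apply, inner_self_eq_norm_sq_to_K, b.orthonormal.1]
    simp
  | succ n =>
    rw [hS.inner_succ_apply, hS.inner_adjoint_apply, b.orthonormal.2 n.succ_ne_zero]
    simp

theorem norm_apply (hS : IsUnilateralShift b S) (f : H) : ‖S f‖ = ‖f‖ := by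
  rw [@norm_eq_sqrt_re_inner 𝕜, ← adjoint_inner_right, hS.adjoint_apply_apply,
    ← @norm_eq_sqrt_re_inner 𝕜]

theorem norm_le_one (hS : IsUnilateralShift b S) : ‖S‖ ≤ 1 :=
  S.opNorm_le_bound zero_le_one fun f => by rw [hS.norm_apply, one_mul]

theorem norm_adjoint_apply_sq (hS : IsUnilateralShift b S) (f : H) :
    ‖adjoint S f‖ ^ 2 = ‖f‖ ^ 2 - ‖inner 𝕜 (b 0) f‖ ^ 2 := by
  have h : inner 𝕜 (adjoint S f) (adjoint S f) =
      inner 𝕜 f f - inner 𝕜 (b 0) f * conj (inner 𝕜 (b 0) f) := by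
    rw [adjoint_inner_left, hS.apply_adjoint_apply, inner_sub_right, inner_smul_right,
      inner_conj_symm]
  rw [inner_self_eq_norm_sq_to_K, inner_self_eq_norm_sq_to_K, RCLike.mul_conj] at h
  exact_mod_cast h

theorem eq_zero_of_mapsTo_adjoint (hS : IsUnilateralShift b S) {N : Set H}
    (hN : Set.MapsTo (adjoint S) N N) (h0 : ∀ f ∈ N, inner 𝕜 (b 0) f = 0) {f : H} (hf : f ∈ N) :
    f = 0 := by
  refine hilbertBasis_ext_inner b fun n => ?_
  rw [inner_zero_right]
  induction n generalizing f with
  | zero => exact h0 f hf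
  | succ n ih => rw [← hS.inner_adjoint_apply, ih (hN hf)]

section Eigenspace

variable {μ : 𝕜} {f : H}

theorem eq_zero_of_mem_eigenspace (hS : IsUnilateralShift b S)
    (hf : f ∈ eigenspace (adjoint S : H →ₗ[𝕜] H) μ) (h0 : inner 𝕜 (b 0) f = 0) : f = 0 := by
  refine hS.eq_zero_of_mapsTo_adjoint
    (N := {g | adjoint S g = μ • g ∧ inner 𝕜 (b 0) g = 0}) ?_ (fun g hg => hg.2)
    ⟨mem_eigenspace_iff.1 hf, h0⟩
  rintro g ⟨hg, hg0⟩
  refine ⟨by rw [hg, map_smul, hg], by rw [hg, inner_smul_right, hg0, mul_zero]⟩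

theorem norm_lt_one_of_mem_eigenspace (hS : IsUnilateralShift b S)
    (hf : f ∈ eigenspace (adjoint S : H →ₗ[𝕜] H) μ) (hf0 : f ≠ 0) : ‖μ‖ < 1 := by
  have h0 : 0 < ‖inner 𝕜 (b 0) f‖ ^ 2 :=
    pow_pos (norm_pos_iff.2 fun h => hf0 (hS.eq_zero_of_mem_eigenspace hf h)) 2
  have hnorm : (‖μ‖ * ‖f‖) ^ 2 = ‖f‖ ^ 2 - ‖inner 𝕜 (b 0) f‖ ^ 2 := by
    rw [← norm_smul, ← hS.norm_adjoint_apply_sq]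
    exact congrArg (‖·‖ ^ 2) (mem_eigenspace_iff.1 hf).symm
  have hlt : ‖μ‖ * ‖f‖ < 1 * ‖f‖ :=
    lt_of_pow_lt_pow_left₀ 2 (by positivity) (by rw [hnorm, one_mul]; linarith)
  exact lt_of_mul_lt_mul_right hlt (norm_nonneg f)

theorem eq_eigenspace_of_le (hS : IsUnilateralShift b S) {Q : Submodule 𝕜 H} (hne : Q ≠ ⊥)
    (hQ : Q ≤ eigenspace (adjoint S : H →ₗ[𝕜] H) μ) :
    Q = eigenspace (adjoint S : H →ₗ[𝕜] H) μ := by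
  refine hQ.antisymm fun f hf => ?_
  obtain ⟨u, huQ, hu⟩ := Submodule.exists_mem_ne_zero_of_ne_bot hne
  have h0 : inner 𝕜 (b 0) u ≠ 0 := fun h => hu (hS.eq_zero_of_mem_eigenspace (hQ huQ) h)
  set c := inner 𝕜 (b 0) f / inner 𝕜 (b 0) u with hc
  have h : f - c • u = 0 := by
    refine hS.eq_zero_of_mem_eigenspace (sub_mem hf (Submodule.smul_mem _ c (hQ huQ))) ?_
    rw [inner_sub_right, inner_smul_right, hc, div_mul_cancel₀ _ h0, sub_self]
  rw [sub_eq_zero.1 h]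
  exact Q.smul_mem c huQ

theorem surjective_one_sub_smul (hS : IsUnilateralShift b S) (hμ : ‖μ‖ < 1) :
    Function.Surjective fun f => f - μ • S f := by
  have hlt : ‖μ • S‖ < 1 := by
    rw [norm_smul]
    exact (mul_le_of_le_one_right (norm_nonneg μ) hS.norm_le_one).trans_lt hμ
  obtain ⟨R, hR⟩ := (isUnit_one_sub_of_norm_lt_one hlt).exists_right_inv
  exact fun g => ⟨R g, DFunLike.congr_fun hR g⟩

end Eigenspace

theorem exists_wandering (hS : IsUnilateralShift b S) {N : Submodule 𝕜 H} [CompleteSpace N]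
    (hN : Set.MapsTo S N N) (hne : N ≠ ⊥) :
    ∃ u ∈ N, ‖u‖ = 1 ∧ ∀ g ∈ N, inner 𝕜 u (S g) = 0 := by
  let K : Submodule 𝕜 H := N.map (S : H →ₗ[𝕜] H)
  have : CompleteSpace K := by
    have hS' : Isometry S := AddMonoidHomClass.isometry_of_norm S hS.norm_apply
    exact ((isComplete_image_iff hS'.isUniformInducing).2
      (completeSpace_coe_iff_isComplete.1 ‹_›)).completeSpace_coe
  have hKN : K ≤ N := Submodule.map_le_iff_le_comap.2 hN
  suffices h : Kᗮ ⊓ N ≠ ⊥ by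
    obtain ⟨v, ⟨hvK, hvN⟩, hv⟩ := Submodule.exists_mem_ne_zero_of_ne_bot h
    refine ⟨(‖v‖⁻¹ : 𝕜) • v, N.smul_mem _ hvN, norm_smul_inv_norm hv, fun g hg => ?_⟩
    rw [inner_smul_left, (Submodule.mem_orthogonal' K v).1 hvK (S g) ⟨g, hg, rfl⟩, mul_zero]
  intro h
  have hNK : N ≤ K := by
    rw [← Submodule.sup_orthogonal_inf_of_hasOrthogonalProjection hKN, h, sup_bot_eq]
  refine hne ((Submodule.eq_bot_iff N).2 fun f => hS.eq_zero_of_mapsTo_adjoint ?_ ?_)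
  · intro g hg
    obtain ⟨k, hk, rfl⟩ := hNK hg
    exact (hS.adjoint_apply_apply k).symm ▸ hk
  · intro g hg
    obtain ⟨k, -, rfl⟩ := hNK hg
    exact hS.inner_zero_apply k

end IsUnilateralShift

end UnilateralShift

namespace IsUnilateralShift

variable {H : Type*} [NormedAddCommGroup H] [InnerProductSpace ℂ H] [CompleteSpace H]
  {b : HilbertBasis ℕ ℂ H} {S : H →L[ℂ] H} {Q : Submodule ℂ H} [CompleteSpace Q]

theorem compression_adjoint_compression (hS : IsUnilateralShift b S)
    (hQ : IsQuotientModule {S} Q) (f : Q) :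
    compression Q S (adjoint (compression Q S) f) =
      f - inner ℂ (Q.orthogonalProjectionOnto (b 0)) f • Q.orthogonalProjectionOnto (b 0) := by
  change Q.orthogonalProjectionOnto (S (adjoint (compression Q S) f : H)) = _
  rw [hQ.coe_adjoint_compression rfl, hS.apply_adjoint_apply, map_sub, map_smul,
    Submodule.orthogonalProjectionOnto_mem_subspace_eq_self,
    Submodule.inner_orthogonalProjectionOnto_eq_of_mem_right]

theorem eq_zero_of_inner_orthogonalProjectionOnto (hS : IsUnilateralShift b S)
    (hQ : IsQuotientModule {S} Q) [hB : IsStarNormal (compression Q S)] {f : Q}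
    (hf : inner ℂ (Q.orthogonalProjectionOnto (b 0)) f = 0) : f = 0 := by
  set B := compression Q S
  set u := Q.orthogonalProjectionOnto (b 0)
  -- `B†` commutes with `B B† = 1 - ⟪u, ·⟫ u`, so it preserves the orthogonal complement of `u`.
  have hcomm (g : Q) : inner ℂ u (adjoint B g) • u = inner ℂ u g • adjoint B u := by
    have h : B (adjoint B (adjoint B g)) = adjoint B (B (adjoint B g)) :=
      DFunLike.congr_fun hB.star_comm_self.eq.symm (adjoint B g)
    rw [hS.compression_adjoint_compression hQ, hS.compression_adjoint_compression hQ, map_sub,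
      map_smul] at h
    exact sub_right_injective h
  refine Subtype.ext (hS.eq_zero_of_mapsTo_adjoint
    (N := (↑) '' {g : Q | inner ℂ u g = 0}) ?_ ?_ ⟨f, hf, rfl⟩)
  · rintro _ ⟨g, hg, rfl⟩
    refine ⟨adjoint B g, ?_, hQ.coe_adjoint_compression rfl g⟩
    have h := hcomm g
    rw [hg, zero_smul, smul_eq_zero] at h
    rcases h with h | h
    · exact h
    · rw [Set.mem_ofPred_eq, h, inner_zero_left]
  · rintro _ ⟨g, hg, rfl⟩
    rwa [← Submodule.inner_orthogonalProjectionOnto_eq_of_mem_right]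

theorem exists_forall_compression_apply_eq_smul (hS : IsUnilateralShift b S)
    (hQ : IsQuotientModule {S} Q) [IsStarNormal (compression Q S)] :
    ∃ a : ℂ, ∀ f, compression Q S f = a • f := by
  set u := Q.orthogonalProjectionOnto (b 0)
  have hspan (f : Q) : f = (inner ℂ u f / inner ℂ u u) • u := by
    refine sub_eq_zero.1 (hS.eq_zero_of_inner_orthogonalProjectionOnto hQ ?_)
    change inner ℂ u _ = 0
    rcases eq_or_ne u 0 with hu | hu
    · rw [hu, inner_zero_left]
    · rw [inner_sub_right, inner_smul_right, div_mul_cancel₀ _ (inner_self_ne_zero.2 hu), sub_self]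
  refine ⟨inner ℂ u (compression Q S u) / inner ℂ u u, fun f => ?_⟩
  rw [hspan f, map_smul, smul_comm, ← hspan (compression Q S u)]

theorem compression_eq_zero_iff (hS : IsUnilateralShift b S) (hQ : IsQuotientModule {S} Q)
    (hne : Q ≠ ⊥) :
    compression Q S = 0 ↔ Q = eigenspace (adjoint S : H →ₗ[ℂ] H) 0 := by
  have h := hQ.forall_compression_apply_eq_smul_iff rfl (a := 0)
  simp only [zero_smul, map_zero] at h
  rw [ContinuousLinearMap.ext_iff]
  exact h.trans ⟨hS.eq_eigenspace_of_le hne, fun h => h.le⟩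

theorem isStarNormal_compression_iff (hS : IsUnilateralShift b S) (hQ : IsQuotientModule {S} Q)
    (hne : Q ≠ ⊥) :
    IsStarNormal (compression Q S) ↔
      ∃ a : ℂ, ‖a‖ < 1 ∧ Q = eigenspace (adjoint S : H →ₗ[ℂ] H) (conj a) := by
  constructor
  · intro hB
    obtain ⟨a, ha⟩ := hS.exists_forall_compression_apply_eq_smul hQ
    rw [hQ.forall_compression_apply_eq_smul_iff rfl] at ha
    obtain ⟨u, huQ, hu⟩ := Submodule.exists_mem_ne_zero_of_ne_bot hne
    refine ⟨a, ?_, hS.eq_eigenspace_of_le hne ha⟩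
    rw [← RCLike.norm_conj]
    exact hS.norm_lt_one_of_mem_eigenspace (ha huQ) hu
  · rintro ⟨a, -, ha⟩
    have hB := (hQ.forall_compression_apply_eq_smul_iff rfl).2 ha.le
    refine ⟨ContinuousLinearMap.ext fun f => ?_⟩
    change adjoint (compression Q S) (compression Q S f) =
      compression Q S (adjoint (compression Q S) f)
    rw [hB, hB, map_smul]

end IsUnilateralShift

/-! ### Multiplication operators and Fourier coefficients -/

section FourierUniqueness

variable {T : ℝ} [Fact (0 < T)]

theorem ext_of_integral_fourier {μ ν : Measure (AddCircle T)} [IsFiniteMeasure μ]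
    [IsFiniteMeasure ν] (h : ∀ n : ℤ, ∫ t, fourier n t ∂μ = ∫ t, fourier n t ∂ν) : μ = ν := by
  let I (ρ : Measure (AddCircle T)) [IsFiniteMeasure ρ] : C(AddCircle T, ℂ) →L[ℂ] ℂ :=
    innerSL ℂ (ContinuousMap.toLp 2 ρ ℂ 1) ∘L ContinuousMap.toLp 2 ρ ℂ
  have I_apply (ρ : Measure (AddCircle T)) [IsFiniteMeasure ρ] (u : C(AddCircle T, ℂ)) :
      I ρ u = ∫ t, u t ∂ρ := by
    simp only [I, ContinuousLinearMap.comp_apply, innerSL_apply_apply, ContinuousMap.inner_toLp,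
      ContinuousMap.one_apply, map_one, mul_one]
  have hI : I μ = I ν := by
    refine ContinuousLinearMap.ext_on
      (Submodule.dense_iff_topologicalClosure_eq_top.2 span_fourier_closure_eq_top) ?_
    rintro _ ⟨n, rfl⟩
    rw [I_apply, I_apply, h]
  refine ext_of_forall_integral_eq_of_IsFiniteMeasure fun f => ?_
  have hf := DFunLike.congr_fun hI ⟨fun t => (f t : ℂ), by fun_prop⟩
  rw [I_apply, I_apply] at hf
  simpa only [ContinuousMap.coe_mk, integral_complex_ofReal, Complex.ofReal_inj] using hf

end FourierUniqueness

section MulLinfty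

variable {X : Type*} [MeasurableSpace X] {μ : Measure X}

/-- Multiplication by an essentially bounded function as an operator on `L²(μ)`. -/
def mulLinfty (θ : Lp ℂ ∞ μ) : Lp ℂ 2 μ →L[ℂ] Lp ℂ 2 μ :=
  (ContinuousLinearMap.mul ℂ ℂ).holderL μ ∞ 2 2 θ

theorem mulLinfty_ae (θ : Lp ℂ ∞ μ) (f : Lp ℂ 2 μ) : mulLinfty θ f =ᵐ[μ] fun x => θ x * f x :=
  (ContinuousLinearMap.mul ℂ ℂ).coeFn_holder (r := 2) θ f

theorem adjoint_mulLinfty (θ : Lp ℂ ∞ μ) :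
    adjoint (mulLinfty θ) = mulLinfty (star θ) := by
  refine ContinuousLinearMap.ext fun f => ext_inner_right ℂ fun g => ?_
  rw [adjoint_inner_left, L2.inner_def, L2.inner_def]
  refine integral_congr_ae ?_
  filter_upwards [mulLinfty_ae θ g, mulLinfty_ae (star θ) f, Lp.coeFn_star θ] with x hg hf hθ
  simp only [RCLike.inner_apply, hg, hf, hθ, Pi.star_apply, RCLike.star_def, map_mul,
    RCLike.conj_conj]
  ring

theorem mulLinfty_mulLinfty_star {θ : Lp ℂ ∞ μ} (hθ : ∀ᵐ x ∂μ, ‖θ x‖ = 1) (f : Lp ℂ 2 μ) :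
    mulLinfty θ (mulLinfty (star θ) f) = f := by
  refine Lp.ext ?_
  filter_upwards [mulLinfty_ae θ (mulLinfty (star θ) f), mulLinfty_ae (star θ) f, Lp.coeFn_star θ,
    hθ] with x h₁ h₂ h₃ h₄
  rw [h₁, h₂, h₃, Pi.star_apply, RCLike.star_def, ← mul_assoc, RCLike.mul_conj, h₄]
  simp

end MulLinfty

section MulL2

variable {X : Type*} [TopologicalSpace X] [CompactSpace X] [MeasurableSpace X] [BorelSpace X]
  {μ : Measure X} [IsFiniteMeasure μ]

theorem inner_mulL2_self (u : C(X, ℂ)) (F : Lp ℂ 2 μ) :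
    inner ℂ F (mulL2 μ u F) = ∫ x, u x * (‖F x‖ ^ 2 : ℝ) ∂μ := by
  rw [L2.inner_def]
  refine integral_congr_ae ?_
  filter_upwards [mulL2_ae μ u F] with x hx
  rw [RCLike.inner_apply, hx, mul_assoc, RCLike.mul_conj]
  norm_cast

theorem inner_mulL2_left (u : C(X, ℂ)) (f g : Lp ℂ 2 μ) :
    inner ℂ (mulL2 μ u f) g = inner ℂ f (mulL2 μ (star u) g) := by
  rw [L2.inner_def, L2.inner_def]
  refine integral_congr_ae ?_
  filter_upwards [mulL2_ae μ u f, mulL2_ae μ (star u) g] with x hf hg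
  simp only [RCLike.inner_apply, hf, hg, map_mul, ContinuousMap.star_apply, RCLike.star_def]
  ring

end MulL2

section Fourier

variable {T : ℝ}

theorem star_fourier (n : ℤ) : star (fourier n : C(AddCircle T, ℂ)) = fourier (-n) :=
  ContinuousMap.ext fun _ => fourier_neg.symm

theorem norm_fourier_apply (n : ℤ) (t : AddCircle T) : ‖fourier n t‖ = 1 :=
  Circle.norm_coe _

variable [Fact (0 < T)]

theorem integral_fourier (n : ℤ) :
    ∫ t, fourier n t ∂(haarAddCircle (T := T)) = if n = 0 then 1 else 0 := by
  have h := congrFun (fourierCoeff_fourier (T := T) n) 0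
  simpa only [fourierCoeff, neg_zero, fourier_zero, one_smul, Pi.single_apply, eq_comm] using h

variable {μ : Measure (AddCircle T)} [IsFiniteMeasure μ]

theorem mulL2_fourier_zero (f : Lp ℂ 2 μ) : mulL2 μ (fourier 0) f = f := by
  refine Lp.ext ?_
  filter_upwards [mulL2_ae μ (fourier 0) f] with t ht
  rw [ht, fourier_zero, one_mul]

theorem mulL2_fourier_add (m n : ℤ) (f : Lp ℂ 2 μ) :
    mulL2 μ (fourier (m + n)) f = mulL2 μ (fourier m) (mulL2 μ (fourier n) f) := by
  refine Lp.ext ?_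
  filter_upwards [mulL2_ae μ (fourier (m + n)) f, mulL2_ae μ (fourier m) (mulL2 μ (fourier n) f),
    mulL2_ae μ (fourier n) f] with t h₁ h₂ h₃
  rw [h₁, h₂, h₃, fourier_add, mul_assoc]

theorem inner_mulL2_fourier_left (n : ℤ) (f g : Lp ℂ 2 μ) :
    inner ℂ (mulL2 μ (fourier n) f) g = inner ℂ f (mulL2 μ (fourier (-n)) g) := by
  rw [inner_mulL2_left, star_fourier]

theorem norm_eq_one_of_inner_mulL2_fourier {F : Lp ℂ 2 (haarAddCircle (T := T))} (hF : ‖F‖ = 1)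
    (h : ∀ n ≠ 0, inner ℂ F (mulL2 haarAddCircle (fourier n) F) = 0) :
    ∀ᵐ t ∂haarAddCircle, ‖F t‖ = 1 := by
  have hint : Integrable (fun t => ‖F t‖ ^ 2) haarAddCircle :=
    (memLp_two_iff_integrable_sq_norm (Lp.aestronglyMeasurable F)).1 (Lp.memLp F)
  set w : AddCircle T → ℝ≥0∞ := fun t => ENNReal.ofReal (‖F t‖ ^ 2) with hw
  have hmeas : AEMeasurable w haarAddCircle := hint.aemeasurable.ennreal_ofReal
  have : IsFiniteMeasure (haarAddCircle.withDensity w) := isFiniteMeasure_withDensity_ofReal hint.2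
  -- `|F|² dt` and `dt` have the same Fourier coefficients.
  have hν : haarAddCircle.withDensity w = haarAddCircle := by
    refine ext_of_integral_fourier fun n => ?_
    have hn : ∫ t, fourier n t ∂haarAddCircle.withDensity w =
        inner ℂ F (mulL2 haarAddCircle (fourier n) F) := by
      rw [integral_withDensity_eq_integral_toReal_smul₀ hmeas (by simp [hw]), inner_mulL2_self]
      simp only [hw, ENNReal.toReal_ofReal (sq_nonneg _), Complex.real_smul, mul_comm]
    rw [hn, integral_fourier]
    split_ifs with h0
    · rw [h0, mulL2_fourier_zero, inner_self_eq_norm_sq_to_K, hF]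
      simp
    · exact h n h0
  have hw1 : w =ᵐ[haarAddCircle] 1 :=
    (withDensity_eq_iff hmeas aemeasurable_const hint.lintegral_lt_top.ne).1
      (hν.trans withDensity_one.symm)
  filter_upwards [hw1] with t ht
  rwa [Pi.one_apply, ENNReal.ofReal_eq_one, pow_eq_one_iff_of_nonneg (norm_nonneg _) two_ne_zero]
    at ht

end Fourier

/-! ### The shift of the Hardy space and Möbius model spaces -/

section HardyDisc

theorem hardyDisc_ext {f g : hardyDisc}
    (h : ∀ n : ℕ, inner ℂ (fourierLp 2 (n : ℤ)) (f : Lp ℂ 2 circleMeasure) =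
      inner ℂ (fourierLp 2 (n : ℤ)) (g : Lp ℂ 2 circleMeasure)) : f = g := by
  refine Subtype.ext (hilbertBasis_ext_inner fourierBasis fun n => ?_)
  rw [coe_fourierBasis]
  rcases lt_or_ge n 0 with hn | hn
  · rw [f.2 n hn, g.2 n hn]
  · lift n to ℕ using hn
    exact h n

theorem fourierLp_mem_hardyDisc (n : ℕ) : fourierLp 2 (n : ℤ) ∈ hardyDisc :=
  fun _ hm => orthonormal_fourier.2 (by omega)

/-- The orthonormal basis of the monomials `z ^ n` of `H²(𝔻)`. -/
def hardyBasis : HilbertBasis ℕ ℂ hardyDisc :=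
  .mkOfOrthogonalEqBot
    (v := fun n => ⟨fourierLp 2 (n : ℤ), fourierLp_mem_hardyDisc n⟩)
    ⟨fun n => orthonormal_fourier.1 n, fun _ _ hmn => orthonormal_fourier.2 (by exact_mod_cast hmn)⟩
    ((Submodule.eq_bot_iff _).2 fun f hf => hardyDisc_ext fun n => by
      rw [ZeroMemClass.coe_zero, inner_zero_right]
      exact (Submodule.mem_orthogonal _ f).1 hf _ (Submodule.subset_span ⟨n, rfl⟩))

theorem coe_hardyBasis (n : ℕ) : (hardyBasis n : Lp ℂ 2 circleMeasure) = fourierLp 2 (n : ℤ) :=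
  congrArg Subtype.val (congrFun (HilbertBasis.coe_mkOfOrthogonalEqBot _ _) n)

theorem hardyShift_ae (f : hardyDisc) :
    (hardyShift f : Lp ℂ 2 circleMeasure) =ᵐ[circleMeasure]
      fun t => fourier 1 t * (f : Lp ℂ 2 circleMeasure) t :=
  mulL2_ae circleMeasure (fourier 1) f

theorem coe_iterate_hardyShift (n : ℕ) (f : hardyDisc) :
    ((hardyShift^[n] f : hardyDisc) : Lp ℂ 2 circleMeasure) =
      mulL2 circleMeasure (fourier n) (f : Lp ℂ 2 circleMeasure) := by
  induction n with
  | zero => exact (mulL2_fourier_zero _).symm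
  | succ n ih =>
    rw [Function.iterate_succ_apply', Nat.cast_succ, add_comm, mulL2_fourier_add, ← ih]
    rfl

theorem mulL2_fourier_fourierLp (m n : ℤ) :
    mulL2 circleMeasure (fourier m) (fourierLp 2 n) = fourierLp 2 (m + n) := by
  refine Lp.ext ?_
  filter_upwards [mulL2_ae circleMeasure (fourier m) (fourierLp 2 n),
    coeFn_fourierLp (T := 1) 2 n, coeFn_fourierLp (T := 1) 2 (m + n)] with t h₁ h₂ h₃
  rw [h₁, h₂, h₃, fourier_add]

theorem isUnilateralShift_hardyShift : IsUnilateralShift hardyBasis hardyShift := fun n => by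
  refine Subtype.ext ?_
  change mulL2 circleMeasure (fourier 1) (hardyBasis n : Lp ℂ 2 circleMeasure) = _
  rw [coe_hardyBasis, coe_hardyBasis, mulL2_fourier_fourierLp, Nat.cast_succ, add_comm]

theorem inner_coe_eq_zero {k : Lp ℂ 2 circleMeasure}
    (hk : ∀ n : ℕ, inner ℂ (fourierLp 2 (n : ℤ)) k = 0) (g : hardyDisc) :
    inner ℂ (g : Lp ℂ 2 circleMeasure) k = 0 := by
  have hproj (g : hardyDisc) := Submodule.inner_orthogonalProjectionOnto_eq_of_mem_left g k
  have h0 : hardyDisc.orthogonalProjectionOnto k = 0 := by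
    refine hilbertBasis_ext_inner hardyBasis fun n => ?_
    rw [hproj, coe_hardyBasis, hk, inner_zero_right]
  rw [← hproj, h0, inner_zero_right]

theorem isInner_of_ae_eq {θ : UnitAddCircle → ℂ} (f : hardyDisc)
    (hf : (f : Lp ℂ 2 circleMeasure) =ᵐ[circleMeasure] θ) (hθ : ∀ᵐ t ∂circleMeasure, ‖θ t‖ = 1) :
    IsInner θ where
  aestronglyMeasurable := (Lp.aestronglyMeasurable _).congr hf
  norm_eq_one := hθ
  fourierCoeff_eq_zero n hn := by
    rw [← fourierCoeff_congr_ae hf, ← fourierBasis_repr, HilbertBasis.repr_apply_apply,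
      coe_fourierBasis]
    exact f.2 n hn

end HardyDisc

section DiscAut

variable {a c : ℂ}

theorem one_sub_conj_mul_fourier_ne_zero (ha : ‖a‖ < 1) (t : UnitAddCircle) :
    1 - conj a * fourier 1 t ≠ 0 := fun h => by
  have hnorm := congrArg norm (sub_eq_zero.1 h)
  rw [norm_mul, RCLike.norm_conj, norm_fourier_apply, norm_one, mul_one] at hnorm
  exact ha.ne' hnorm

theorem norm_discAut (ha : ‖a‖ < 1) (hc : ‖c‖ = 1) (t : UnitAddCircle) : ‖discAut a c t‖ = 1 := by
  have h0 := one_sub_conj_mul_fourier_ne_zero ha t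
  have hz : fourier 1 t * conj (fourier 1 t) = 1 := by
    rw [RCLike.mul_conj, norm_fourier_apply]
    simp
  have hnum : fourier 1 t - a = fourier 1 t * conj (1 - conj a * fourier 1 t) := by
    simp only [map_sub, map_one, map_mul, RCLike.conj_conj]
    linear_combination a * hz
  rw [discAut, hnum, norm_mul, norm_div, norm_mul, RCLike.norm_conj, norm_fourier_apply, hc,
    one_mul, one_mul, div_self (norm_ne_zero_iff.2 h0)]

theorem discAut_mul_ae (ha : ‖a‖ < 1) (c : ℂ) (h : hardyDisc) :
    ((c • (hardyShift h - a • h) : hardyDisc) : Lp ℂ 2 circleMeasure) =ᵐ[circleMeasure]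
      fun t => discAut a c t *
        ((h - conj a • hardyShift h : hardyDisc) : Lp ℂ 2 circleMeasure) t := by
  simp only [Submodule.coe_smul, Submodule.coe_sub]
  filter_upwards [hardyShift_ae h,
    Lp.coeFn_smul c ((hardyShift h : Lp ℂ 2 circleMeasure) - a • (h : Lp ℂ 2 circleMeasure)),
    Lp.coeFn_sub (hardyShift h : Lp ℂ 2 circleMeasure) (a • (h : Lp ℂ 2 circleMeasure)),
    Lp.coeFn_smul a (h : Lp ℂ 2 circleMeasure),
    Lp.coeFn_sub (h : Lp ℂ 2 circleMeasure) (conj a • (hardyShift h : Lp ℂ 2 circleMeasure)),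
    Lp.coeFn_smul (conj a) (hardyShift h : Lp ℂ 2 circleMeasure)] with t h₁ h₂ h₃ h₄ h₅ h₆
  have h0 := one_sub_conj_mul_fourier_ne_zero ha t
  simp only [h₂, h₃, h₄, h₅, h₆, h₁, Pi.smul_apply, Pi.sub_apply, smul_eq_mul, discAut]
  rw [← mul_assoc (conj a), ← one_sub_mul, ← mul_assoc, mul_assoc c, div_mul_cancel₀ _ h0,
    mul_assoc, sub_mul]

theorem mem_mulHardy_discAut (ha : ‖a‖ < 1) {f : hardyDisc} :
    f ∈ mulHardy (discAut a c) ↔ ∃ h, c • (hardyShift h - a • h) = f := by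
  constructor
  · rintro ⟨g, hg⟩
    obtain ⟨h, rfl⟩ := isUnilateralShift_hardyShift.surjective_one_sub_smul
      ((RCLike.norm_conj a).trans_lt ha) g
    exact ⟨h, Subtype.ext (Lp.ext ((discAut_mul_ae ha c h).trans hg.symm))⟩
  · rintro ⟨h, rfl⟩
    exact ⟨_, discAut_mul_ae ha c h⟩

theorem modelSpace_discAut (ha : ‖a‖ < 1) (hc : c ≠ 0) :
    modelSpace (discAut a c) =
      eigenspace (adjoint hardyShift : hardyDisc →ₗ[ℂ] hardyDisc) (conj a) := by
  ext f
  rw [modelSpace, Submodule.mem_orthogonal, mem_eigenspace_adjoint_iff hc]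
  simp only [mem_mulHardy_discAut ha, forall_exists_index, forall_apply_eq_imp_iff]

theorem isInner_discAut (ha : ‖a‖ < 1) (hc : ‖c‖ = 1) : IsInner (discAut a c) := by
  obtain ⟨h, hh : h - conj a • hardyShift h = hardyBasis 0⟩ :=
    isUnilateralShift_hardyShift.surjective_one_sub_smul ((RCLike.norm_conj a).trans_lt ha) _
  refine isInner_of_ae_eq (c • (hardyShift h - a • h)) ?_ (.of_forall (norm_discAut ha hc))
  filter_upwards [discAut_mul_ae ha c h, coeFn_fourierLp (T := 1) 2 0] with t h₁ h₂
  rw [h₁, hh, coe_hardyBasis, Nat.cast_zero, h₂, fourier_zero, mul_one]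

end DiscAut

/-! ### Beurling's theorem -/

section Beurling

variable {θ : Lp ℂ ∞ circleMeasure}

theorem mem_mulHardy_iff {f : hardyDisc} :
    f ∈ mulHardy θ ↔ ∃ g : hardyDisc, mulLinfty θ g = (f : Lp ℂ 2 circleMeasure) :=
  exists_congr fun g =>
    ⟨fun h => Lp.ext ((mulLinfty_ae θ g).trans h.symm), fun h => h ▸ mulLinfty_ae θ g⟩

theorem mulLinfty_fourierLp {F : Lp ℂ 2 circleMeasure} (hF : F =ᵐ[circleMeasure] θ) (n : ℤ) :
    mulLinfty θ (fourierLp 2 n) = mulL2 circleMeasure (fourier n) F := by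
  refine Lp.ext ?_
  filter_upwards [mulLinfty_ae θ (fourierLp 2 n), mulL2_ae circleMeasure (fourier n) F,
    coeFn_fourierLp (T := 1) 2 n, hF] with t h₁ h₂ h₃ h₄
  rw [h₁, h₂, h₃, h₄, mul_comm]

theorem inner_fourierLp_mulLinfty_star {F : Lp ℂ 2 circleMeasure} (hF : F =ᵐ[circleMeasure] θ)
    (n : ℤ) (f : Lp ℂ 2 circleMeasure) :
    inner ℂ (fourierLp 2 n) (mulLinfty (star θ) f) =
      inner ℂ (mulL2 circleMeasure (fourier n) F) f := by
  rw [← adjoint_mulLinfty, adjoint_inner_right, mulLinfty_fourierLp hF]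

theorem eq_zero_of_inner_mulL2_fourier (hθ : ∀ᵐ t ∂circleMeasure, ‖θ t‖ = 1)
    {F f : Lp ℂ 2 circleMeasure} (hF : F =ᵐ[circleMeasure] θ)
    (h : ∀ n : ℤ, inner ℂ (mulL2 circleMeasure (fourier n) F) f = 0) : f = 0 := by
  have h0 : mulLinfty (star θ) f = 0 := hilbertBasis_ext_inner fourierBasis fun n => by
    rw [coe_fourierBasis, inner_fourierLp_mulLinfty_star hF, h, inner_zero_right]
  rw [← mulLinfty_mulLinfty_star hθ f, h0, map_zero]

theorem mem_modelSpace_iff {φ : hardyDisc} (hφ : (φ : Lp ℂ 2 circleMeasure) =ᵐ[circleMeasure] θ)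
    {f : hardyDisc} : f ∈ modelSpace θ ↔ ∀ n : ℕ, inner ℂ (hardyShift^[n] φ) f = 0 := by
  rw [modelSpace, Submodule.mem_orthogonal]
  constructor
  · intro h n
    refine h _ (mem_mulHardy_iff.2 ⟨hardyBasis n, ?_⟩)
    rw [coe_hardyBasis, mulLinfty_fourierLp hφ, coe_iterate_hardyShift]
  · intro h g hg
    obtain ⟨g', hg'⟩ := mem_mulHardy_iff.1 hg
    rw [Submodule.coe_inner, ← hg', ← adjoint_inner_right, adjoint_mulLinfty]
    refine inner_coe_eq_zero (fun n => ?_) g'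
    rw [inner_fourierLp_mulLinfty_star hφ, ← coe_iterate_hardyShift]
    exact h n

theorem norm_eq_one_of_inner_iterate_hardyShift {φ : hardyDisc} (hφ : ‖φ‖ = 1)
    (h : ∀ n ≠ 0, inner ℂ φ (hardyShift^[n] φ) = 0) :
    ∀ᵐ t ∂circleMeasure, ‖(φ : Lp ℂ 2 circleMeasure) t‖ = 1 := by
  refine norm_eq_one_of_inner_mulL2_fourier hφ fun n hn => ?_
  have hnat (m : ℕ) (hm : m ≠ 0) :
      inner ℂ (φ : Lp ℂ 2 circleMeasure) (mulL2 circleMeasure (fourier m) φ) = 0 := by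
    rw [← coe_iterate_hardyShift]
    exact h m hm
  obtain ⟨m, rfl | rfl⟩ := n.eq_nat_or_neg
  · exact hnat m (by simpa using hn)
  · rw [← inner_mulL2_fourier_left, ← inner_conj_symm, hnat m (by simpa using hn), map_zero]

theorem exists_Linfty_ae_eq {F : Lp ℂ 2 circleMeasure} (hF : ∀ᵐ t ∂circleMeasure, ‖F t‖ = 1) :
    ∃ θ : Lp ℂ ∞ circleMeasure, F =ᵐ[circleMeasure] θ :=
  ⟨_, (memLp_top_of_bound (Lp.aestronglyMeasurable F) 1
    (hF.mono fun _ h => h.le)).coeFn_toLp.symm⟩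

variable {Q : Submodule ℂ hardyDisc}

theorem orthogonal_inf_modelSpace_eq_bot {φ : hardyDisc}
    (hθ : ∀ᵐ t ∂circleMeasure, ‖θ t‖ = 1)
    (hφ : (φ : Lp ℂ 2 circleMeasure) =ᵐ[circleMeasure] θ)
    (hwander : ∀ g ∈ Qᗮ, ∀ n ≠ 0, inner ℂ φ (hardyShift^[n] g) = 0) :
    Qᗮ ⊓ modelSpace θ = ⊥ := by
  refine (Submodule.eq_bot_iff _).2 fun f ⟨hfQ, hfθ⟩ =>
    Subtype.ext (eq_zero_of_inner_mulL2_fourier hθ hφ fun n => ?_)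
  rcases le_or_gt 0 n with hn | hn
  · lift n to ℕ using hn
    rw [← coe_iterate_hardyShift]
    exact (mem_modelSpace_iff hφ).1 hfθ n
  · obtain ⟨m, rfl⟩ := Int.exists_eq_neg_ofNat hn.le
    rw [inner_mulL2_fourier_left, neg_neg, ← coe_iterate_hardyShift]
    exact hwander f hfQ m (by omega)

theorem exists_eq_modelSpace (hQ : IsQuotientModule {hardyShift} Q) (htop : Q ≠ ⊤) :
    ∃ θ, IsInner θ ∧ Q = modelSpace θ := by
  have : CompleteSpace Q := hQ.isClosed.completeSpace_coe
  have hmaps : Set.MapsTo hardyShift Qᗮ Qᗮ := fun g hg => hQ.apply_mem_orthogonal rfl hg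
  obtain ⟨φ, hφQ, hφ1, hφ⟩ := isUnilateralShift_hardyShift.exists_wandering hmaps
    (mt Submodule.orthogonal_eq_bot_iff.1 htop)
  have hwander (g) (hg : g ∈ Qᗮ) (n : ℕ) (hn : n ≠ 0) : inner ℂ φ (hardyShift^[n] g) = 0 := by
    obtain ⟨m, rfl⟩ := Nat.exists_eq_succ_of_ne_zero hn
    rw [Function.iterate_succ_apply']
    exact hφ _ (hmaps.iterate m hg)
  have hnorm := norm_eq_one_of_inner_iterate_hardyShift hφ1 (hwander φ hφQ)
  obtain ⟨θ, hφθ⟩ := exists_Linfty_ae_eq hnorm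
  have hθ : ∀ᵐ t ∂circleMeasure, ‖θ t‖ = 1 := by
    filter_upwards [hnorm, hφθ] with t h₁ h₂
    rwa [← h₂]
  have hle : Q ≤ modelSpace θ := fun f hf => (mem_modelSpace_iff hφθ).2 fun n =>
    (Submodule.mem_orthogonal' Q _).1 (hmaps.iterate n hφQ) f hf
  refine ⟨θ, isInner_of_ae_eq φ hφθ hθ, ?_⟩
  rw [← Submodule.sup_orthogonal_inf_of_hasOrthogonalProjection hle,
    orthogonal_inf_modelSpace_eq_bot hθ hφθ hwander, sup_bot_eq]

end Beurling

/-! ### Hilbert space tensor products -/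

section HilbertTensor

variable {𝕜 E F G : Type*} [RCLike 𝕜]
  [NormedAddCommGroup E] [InnerProductSpace 𝕜 E] [NormedAddCommGroup F] [InnerProductSpace 𝕜 F]
  [NormedAddCommGroup G] [InnerProductSpace 𝕜 G]

variable (𝕜) in
/-- `G` is the Hilbert space tensor product of `E` and `F`, with elementary tensors `τ f g`. The
bilinearity of `τ` is a consequence of the two conditions. -/
structure IsHilbertTensor (τ : E → F → G) : Prop where
  inner_tmul : ∀ f g f' g', inner 𝕜 (τ f g) (τ f' g') = inner 𝕜 f f' * inner 𝕜 g g'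
  eq_zero : ∀ x, (∀ f g, inner 𝕜 (τ f g) x = 0) → x = 0

namespace IsHilbertTensor

variable {τ : E → F → G}

theorem ext_inner (hτ : IsHilbertTensor 𝕜 τ) {x y : G}
    (h : ∀ f g, inner 𝕜 (τ f g) x = inner 𝕜 (τ f g) y) : x = y :=
  sub_eq_zero.1 (hτ.eq_zero _ fun f g => by rw [inner_sub_right, h, sub_self])

theorem zero_tmul (hτ : IsHilbertTensor 𝕜 τ) (g : F) : τ 0 g = 0 := by
  rw [← inner_self_eq_zero (𝕜 := 𝕜), hτ.inner_tmul, inner_zero_left, zero_mul]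

theorem tmul_zero (hτ : IsHilbertTensor 𝕜 τ) (f : E) : τ f 0 = 0 := by
  rw [← inner_self_eq_zero (𝕜 := 𝕜), hτ.inner_tmul, inner_zero_left, mul_zero]

theorem nontrivial [Nontrivial G] (hτ : IsHilbertTensor 𝕜 τ) : Nontrivial E ∧ Nontrivial F := by
  obtain ⟨x, hx⟩ := exists_ne (0 : G)
  constructor <;> by_contra! <;>
    refine hx (hτ.eq_zero x fun f g => ?_)
  · rw [Subsingleton.elim f 0, hτ.zero_tmul, inner_zero_left]
  · rw [Subsingleton.elim g 0, hτ.tmul_zero, inner_zero_left]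

theorem tmul_left_cancel (hτ : IsHilbertTensor 𝕜 τ) {f : E} (hf : f ≠ 0) {g g' : F}
    (h : τ f g = τ f g') : g = g' := by
  refine ext_inner_left 𝕜 fun k => mul_left_cancel₀ ((inner_self_ne_zero (𝕜 := 𝕜)).2 hf) ?_
  rw [← hτ.inner_tmul, ← hτ.inner_tmul, h]

variable [CompleteSpace G]

theorem clm_ext (hτ : IsHilbertTensor 𝕜 τ) {X Y : G →L[𝕜] G} (h : ∀ f g, X (τ f g) = Y (τ f g)) :
    X = Y := by
  refine (adjoint (𝕜 := 𝕜) (E := G) (F := G)).injective (ContinuousLinearMap.ext fun x => ?_)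
  exact hτ.ext_inner fun f g => by rw [adjoint_inner_right, adjoint_inner_right, h]

theorem adjoint_tmul [CompleteSpace F] (hτ : IsHilbertTensor 𝕜 τ) {Y : G →L[𝕜] G} {B : F →L[𝕜] F}
    (hY : ∀ f g, Y (τ f g) = τ f (B g)) (f : E) (g : F) :
    adjoint Y (τ f g) = τ f (adjoint B g) :=
  hτ.ext_inner fun f' g' => by
    rw [adjoint_inner_right, hY, hτ.inner_tmul, hτ.inner_tmul, adjoint_inner_right]

theorem comp_comp_adjoint_eq_iff [CompleteSpace F] (hτ : IsHilbertTensor 𝕜 τ)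
    {X Y : G →L[𝕜] G} {A : E →L[𝕜] E} {B : F →L[𝕜] F}
    (hX : ∀ f g, X (τ f g) = τ (A f) g) (hY : ∀ f g, Y (τ f g) = τ f (B g)) :
    X ∘L Y ∘L adjoint Y = adjoint Y ∘L X ∘L Y ↔ A = 0 ∨ IsStarNormal B := by
  have htmul : X ∘L Y ∘L adjoint Y = adjoint Y ∘L X ∘L Y ↔
      ∀ f g, τ (A f) (B (adjoint B g)) = τ (A f) (adjoint B (B g)) := by
    have hleft (f : E) (g : F) : (X ∘L Y ∘L adjoint Y) (τ f g) = τ (A f) (B (adjoint B g)) := by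
      simp only [ContinuousLinearMap.comp_apply, hτ.adjoint_tmul hY, hX, hY]
    have hright (f : E) (g : F) : (adjoint Y ∘L X ∘L Y) (τ f g) = τ (A f) (adjoint B (B g)) := by
      simp only [ContinuousLinearMap.comp_apply, hτ.adjoint_tmul hY, hX, hY]
    simp only [← hleft, ← hright]
    exact ⟨fun h f g => DFunLike.congr_fun h (τ f g), hτ.clm_ext⟩
  rw [htmul]
  constructor
  · rw [or_iff_not_imp_left]
    intro h hA
    obtain ⟨f, hf⟩ := DFunLike.ne_iff.1 hA
    exact ⟨ContinuousLinearMap.ext fun g => (hτ.tmul_left_cancel hf (h f g)).symm⟩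
  · rintro (rfl | hB) f g
    · simp only [zero_apply, hτ.zero_tmul]
    · exact congrArg (τ (A f)) (DFunLike.congr_fun hB.star_comm_self.eq.symm g)

end IsHilbertTensor

end HilbertTensor

section Bidisc

theorem pureTensor_ae (f g : hardyDisc) :
    (pureTensor f g : Lp ℂ 2 torusMeasure) =ᵐ[torusMeasure] fun p =>
      (f : Lp ℂ 2 circleMeasure) p.1 * (g : Lp ℂ 2 circleMeasure) p.2 :=
  (memLp_pureTensor f g).coeFn_toLp

theorem inner_pureTensor (f g f' g' : hardyDisc) :
    inner ℂ (pureTensor f g) (pureTensor f' g') = inner ℂ f f' * inner ℂ g g' := by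
  simp only [Submodule.coe_inner, L2.inner_def, ← integral_prod_mul]
  refine integral_congr_ae ?_
  filter_upwards [pureTensor_ae f g, pureTensor_ae f' g'] with p h₁ h₂
  simp only [RCLike.inner_apply, h₁, h₂, map_mul]
  ring

theorem bidiscShift₁_pureTensor (f g : hardyDisc) :
    bidiscShift₁ (pureTensor f g) = pureTensor (hardyShift f) g := by
  refine Subtype.ext (Lp.ext ?_)
  filter_upwards [mulL2_ae torusMeasure (torusMonomial 1 0) (pureTensor f g : Lp ℂ 2 torusMeasure),
    pureTensor_ae f g, pureTensor_ae (hardyShift f) g,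
    Measure.quasiMeasurePreserving_fst.ae (hardyShift_ae f)] with p h₁ h₂ h₃ h₄
  refine h₁.trans ?_
  rw [h₂, h₃, h₄]
  simp only [torusMonomial, ContinuousMap.coe_mk, fourier_zero]
  ring

theorem bidiscShift₂_pureTensor (f g : hardyDisc) :
    bidiscShift₂ (pureTensor f g) = pureTensor f (hardyShift g) := by
  refine Subtype.ext (Lp.ext ?_)
  filter_upwards [mulL2_ae torusMeasure (torusMonomial 0 1) (pureTensor f g : Lp ℂ 2 torusMeasure),
    pureTensor_ae f g, pureTensor_ae f (hardyShift g),
    Measure.quasiMeasurePreserving_snd.ae (hardyShift_ae g)] with p h₁ h₂ h₃ h₄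
  refine h₁.trans ?_
  rw [h₂, h₃, h₄]
  simp only [torusMonomial, ContinuousMap.coe_mk, fourier_zero]
  ring

theorem eq_zero_of_mem_topologicalClosure_span {𝕜 E : Type*} [RCLike 𝕜] [NormedAddCommGroup E]
    [InnerProductSpace 𝕜 E] {s : Set E} {x : E}
    (hx : x ∈ (Submodule.span 𝕜 s).topologicalClosure) (h : ∀ y ∈ s, inner 𝕜 y x = 0) : x = 0 := by
  have hs : Submodule.span 𝕜 s ≤ (𝕜 ∙ x)ᗮ := Submodule.span_le.2 fun y hy =>
    Submodule.mem_orthogonal_singleton_iff_inner_left.2 (h y hy)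
  exact inner_self_eq_zero.1 (Submodule.mem_orthogonal_singleton_iff_inner_left.1
    (Submodule.topologicalClosure_minimal _ hs (Submodule.isClosed_orthogonal _) hx))

variable {Q₁ Q₂ : Submodule ℂ hardyDisc}

/-- The elementary tensor `f z * g w` as an element of `Q₁ ⊗ Q₂`. -/
def tmul (f : Q₁) (g : Q₂) : tensorSubspace Q₁ Q₂ :=
  ⟨pureTensor f g, Submodule.le_topologicalClosure _
    (Submodule.subset_span ⟨f, f.2, g, g.2, rfl⟩)⟩

theorem isHilbertTensor_tmul : IsHilbertTensor ℂ (tmul : Q₁ → Q₂ → tensorSubspace Q₁ Q₂) where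
  inner_tmul f g f' g' := inner_pureTensor f g f' g'
  eq_zero x h := Subtype.ext <| eq_zero_of_mem_topologicalClosure_span x.2 <| by
    rintro _ ⟨f, hf, g, hg, rfl⟩
    exact h ⟨f, hf⟩ ⟨g, hg⟩

theorem ne_bot_of_tensorSubspace_ne_bot (hne : tensorSubspace Q₁ Q₂ ≠ ⊥) : Q₁ ≠ ⊥ ∧ Q₂ ≠ ⊥ := by
  rw [← Submodule.nontrivial_iff_ne_bot] at hne
  simpa only [Submodule.nontrivial_iff_ne_bot] using isHilbertTensor_tmul.nontrivial

theorem compression_bidiscShift₁_tmul [CompleteSpace Q₁] (f : Q₁) (g : Q₂) :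
    compression (tensorSubspace Q₁ Q₂) bidiscShift₁ (tmul f g) =
      tmul (compression Q₁ hardyShift f) g := by
  refine isHilbertTensor_tmul.ext_inner fun f' g' => ?_
  rw [inner_compression, isHilbertTensor_tmul.inner_tmul, inner_compression, Submodule.coe_inner Q₂,
    ← inner_pureTensor, ← bidiscShift₁_pureTensor]
  rfl

theorem compression_bidiscShift₂_tmul [CompleteSpace Q₂] (f : Q₁) (g : Q₂) :
    compression (tensorSubspace Q₁ Q₂) bidiscShift₂ (tmul f g) =
      tmul f (compression Q₂ hardyShift g) := by
  refine isHilbertTensor_tmul.ext_inner fun f' g' => ?_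
  rw [inner_compression, isHilbertTensor_tmul.inner_tmul, inner_compression, Submodule.coe_inner Q₁,
    ← inner_pureTensor, ← bidiscShift₂_pureTensor]
  rfl

end Bidisc

section QuotientModule

variable {Q₁ Q₂ : Submodule ℂ hardyDisc}

theorem exists_eq_modelSpace_discAut_iff {Q : Submodule ℂ hardyDisc} {a : ℂ} (ha : ‖a‖ < 1) :
    (∃ c : ℂ, ‖c‖ = 1 ∧ Q = modelSpace (discAut a c)) ↔
      Q = eigenspace (adjoint hardyShift : hardyDisc →ₗ[ℂ] hardyDisc) (conj a) := by
  constructor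
  · rintro ⟨c, hc, rfl⟩
    exact modelSpace_discAut ha (norm_ne_zero_iff.1 (hc ▸ one_ne_zero))
  · rintro rfl
    exact ⟨1, norm_one, (modelSpace_discAut ha one_ne_zero).symm⟩

theorem isPhiDoublyCommuting_tensorSubspace_iff [CompleteSpace Q₁] [CompleteSpace Q₂]
    (hQ₁ : IsQuotientModule {hardyShift} Q₁) (hQ₂ : IsQuotientModule {hardyShift} Q₂)
    (hne : tensorSubspace Q₁ Q₂ ≠ ⊥) :
    IsPhiDoublyCommuting bidiscShift₁ bidiscShift₂ (tensorSubspace Q₁ Q₂) ↔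
      (∃ c : ℂ, ‖c‖ = 1 ∧ Q₁ = modelSpace (discAut 0 c)) ∨
        ∃ a : ℂ, ‖a‖ < 1 ∧ ∃ c : ℂ, ‖c‖ = 1 ∧ Q₂ = modelSpace (discAut a c) := by
  obtain ⟨hne₁, hne₂⟩ := ne_bot_of_tensorSubspace_ne_bot hne
  refine (isHilbertTensor_tmul.comp_comp_adjoint_eq_iff compression_bidiscShift₁_tmul
    compression_bidiscShift₂_tmul).trans (or_congr ?_ ?_)
  · rw [exists_eq_modelSpace_discAut_iff (by simp), map_zero]
    exact isUnilateralShift_hardyShift.compression_eq_zero_iff hQ₁ hne₁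
  · refine (isUnilateralShift_hardyShift.isStarNormal_compression_iff hQ₂ hne₂).trans ?_
    exact exists_congr fun a => and_congr_right fun ha => (exists_eq_modelSpace_discAut_iff ha).symm

end QuotientModule

end

theorem theorem3p5 (Q₁ Q₂ : Submodule ℂ hardyDisc)
    (hQ₁ : IsQuotientModule {hardyShift} Q₁) (hQ₂ : IsQuotientModule {hardyShift} Q₂)
    (hQ : IsQuotientModule {bidiscShift₁, bidiscShift₂} (tensorSubspace Q₁ Q₂))
    (hne : tensorSubspace Q₁ Q₂ ≠ ⊥)
    (hdc : IsDoublyCommuting bidiscShift₁ bidiscShift₂ (tensorSubspace Q₁ Q₂)) :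
    IsPhiDoublyCommuting bidiscShift₁ bidiscShift₂ (tensorSubspace Q₁ Q₂) ↔
      (∃ a c : ℂ, ‖a‖ < 1 ∧ ‖c‖ = 1 ∧ Q₁ = ⊤ ∧ Q₂ = modelSpace (discAut a c)) ∨
      (∃ c : ℂ, ‖c‖ = 1 ∧ Q₁ = modelSpace (discAut 0 c) ∧ Q₂ = ⊤) ∨
      (∃ θ₁ θ₂ : UnitAddCircle → ℂ, IsInner θ₁ ∧ IsInner θ₂ ∧
        Q₁ = modelSpace θ₁ ∧ Q₂ = modelSpace θ₂ ∧
        ((∃ c : ℂ, ‖c‖ = 1 ∧ θ₁ = discAut 0 c) ∨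
          (∃ a c : ℂ, ‖a‖ < 1 ∧ ‖c‖ = 1 ∧ θ₂ = discAut a c))) := by
  have : CompleteSpace Q₁ := hQ₁.isClosed.completeSpace_coe
  have : CompleteSpace Q₂ := hQ₂.isClosed.completeSpace_coe
  rw [isPhiDoublyCommuting_tensorSubspace_iff hQ₁ hQ₂ hne]
  constructor
  · rintro (⟨c, hc, h₁⟩ | ⟨a, ha, c, hc, h₂⟩)
    · by_cases htop : Q₂ = ⊤
      · exact .inr (.inl ⟨c, hc, h₁, htop⟩)
      · obtain ⟨θ, hθ, h₂⟩ := exists_eq_modelSpace hQ₂ htop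
        exact .inr (.inr ⟨_, θ, isInner_discAut (by simp) hc, hθ, h₁, h₂, .inl ⟨c, hc, rfl⟩⟩)
    · by_cases htop : Q₁ = ⊤
      · exact .inl ⟨a, c, ha, hc, htop, h₂⟩
      · obtain ⟨θ, hθ, h₁⟩ := exists_eq_modelSpace hQ₁ htop
        exact .inr (.inr ⟨θ, _, hθ, isInner_discAut ha hc, h₁, h₂, .inr ⟨a, c, ha, hc, rfl⟩⟩)
  · rintro (⟨a, c, ha, hc, -, h₂⟩ | ⟨c, hc, h₁, -⟩ |
      ⟨θ₁, θ₂, -, -, h₁, h₂, ⟨c, hc, rfl⟩ | ⟨a, c, ha, hc, rfl⟩⟩)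
    · exact .inr ⟨a, ha, c, hc, h₂⟩
    · exact .inl ⟨c, hc, h₁⟩
    · exact .inl ⟨c, hc, h₁⟩
    · exact .inr ⟨a, ha, c, hc, h₂⟩
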